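/- Let $n\ge 4$ be an even integer and write $\mathbb N_n=\{1,\dots,n\}$; let $\binom{\mathbb N_n}{r}$ be the collection of all $r$-subsets of $\mathbb N_n$. For $\mathscr F\subseteq\binom{\mathbb N_n}{r}$, the shadow $\Delta\mathscr F$ is the collection of $(r-1)$-sets contained in some member of $\mathscr F$, and the shade $\nabla\mathscr F$ is the collection of $(r+1)$-subsets of $\mathbb N_n$ containing some member of $\mathscr F$. In the squashed order on $\binom{\mathbb N_n}{r}$, $A$ strictly precedes $B$ iff $A\ne B$ and the largest element of the symmetric difference of $A$ and $B$ lies in $B$; $F_{n,r}(m)$ and $L_{n,r}(m)$ denote the collections of the first and of the last $m$ $r$-subsets of $\mathbb N_n$ in this order. Let $\kappa_{n,r}(i)=|\Delta F_{n,r}(i)|-i$ and $\kappa^*_{n,r}(i)=\min_{0\le j\le i}\kappa_{n,r}(j)$. Let $\mathscr A=\{A_1,\dots,A_{|\mathscr A|}\}$ and $\mathscr B=\{B_1,\dots,B_{|\mathscr B|}\}$ be two antichains of subsets of $\mathbb N_n$ (with distinct members as listed), and let $0\le k\le\min\{|\mathscr A|,|\mathscr B|\}$ be an integer such that for all $i,j$,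 $A_i\cap B_j=\emptyset$ only if $i=j\le k$. Suppose that $$|\mathscr A|+|\mathscr B|=\binom{n}{n/2}+\binom{n}{n/2+1}-\kappa^*_{n,n/2}(k).$$ Then for each $\mathscr X\in\{\mathscr A,\mathscr B\}$, writing $\mathscr X^{(n/2)}$ for the collection of $n/2$-sets in $\mathscr X$: (i) $\mathscr X\subseteq\binom{\mathbb N_n}{n/2}\cup\binom{\mathbb N_n}{n/2+1}$; (ii) $\mathscr X=\mathscr X^{(n/2)}\cup\Big(\binom{\mathbb N_n}{n/2+1}\setminus\nabla\mathscr X^{(n/2)}\Big)$; (iii) $|\nabla\mathscr X^{(n/2)}|=|\nabla L_{n,n/2}(|\mathscr X^{(n/2)}|)|$, and this is the minimum possible: $|\nabla\mathscr X^{(n/2)}|\le|\nabla\mathscr G|$ for every $\mathscr G\subseteq\binom{\mathbb N_n}{n/2}$ with $|\mathscr G|=|\mathscr X^{(n/2)}|$. -/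

import Mathlib

open scoped FinsetFamily

namespace CrossAntichain

/-- The collection of all `r`-subsets of the `n`-element ground set. The ground set `{1, …, n}` is
modelled by the linearly ordered type `Fin n`. -/
def level (n r : ℕ) : Finset (Finset (Fin n)) :=
  Finset.powersetCard r Finset.univ

/-- The first `m` of the `r`-subsets in squashed order: the `r`-sets having fewer than `m` strict
predecessors. The squashed order (`A < B` iff the largest element of the symmetric difference lies
in `B`) is the colexicographic order of Mathlib. -/
def firstSets (n r m : ℕ) : Finset (Finset (Fin n)) :=
  (level n r).filter fun S =>
    ((level n r).filter fun T => toColex T < toColex S).card < m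

/-- The last `m` of the `r`-subsets in squashed order: the `r`-sets having fewer than `m` strict
successors. -/
def lastSets (n r m : ℕ) : Finset (Finset (Fin n)) :=
  (level n r).filter fun S =>
    ((level n r).filter fun T => toColex S < toColex T).card < m

/-- The Kruskal-Katona function: the size of the shadow of the first `i` of the `r`-subsets in
squashed order, minus `i`. -/
def kappa (n r i : ℕ) : ℤ :=
  ((∂ (firstSets n r i)).card : ℤ) - (i : ℤ)

/-- The minimum of `kappa n r j` over `0 ≤ j ≤ i`. -/
def kappaStar (n r i : ℕ) : ℤ :=
  (Finset.range (i + 1)).inf' Finset.nonempty_range_add_one (kappa n r)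

end CrossAntichain

namespace CrossAntichain

open Finset

/-! Write n = 2h. Replacing each member of ℬ that misses a member of 𝒜 by complements of members of
𝒜 leaves 𝒜 alone, does not shrink ℬ, and makes disjoint pairs complementary, at most k of them
(`exists_isComplPair`). By local LYM, a lowest level below h can then be pushed up and a highest
level above h + 1 pushed down with strict gain, so an extremal pair lives on levels h and h + 1.

There let P and Q be the h-slices. Each family has at most |P| + C(n,h+1) - |∂⁺P| members (likewise
for Q), and |P| + |Q| ≤ C(n,h) + k. Submodularity of the shade turns P, Q into the full level and a
residue R with |R| ≤ k, and Kruskal–Katona bounds |∂⁺R| - |R| below by `kappaStar`; for smaller P, Q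
local LYM suffices (`card_add_card_add_choose_le`).

Equality makes every step tight. That bound sees P only through |P| and |∂⁺P|, so |∂⁺P| must be
minimal for its size. Exchanging the roles of 𝒜 and ℬ handles ℬ. -/

/-- Rank is injective on `s` with values below `s.card`, so it takes each such value exactly once.
-/
lemma card_filter_card_lt {α β : Type*} [LinearOrder β] (s : Finset α) {f : α → β}
    (hf : Function.Injective f) {m : ℕ} (hm : m ≤ s.card) :
    (s.filter fun x => (s.filter fun y => f y < f x).card < m).card = m := by
  classical
  set rank : α → ℕ := fun x => (s.filter fun y => f y < f x).card with hrank
  have hmono : ∀ x ∈ s, ∀ y ∈ s, f x < f y → rank x < rank y := by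
    intro x hx y hy hxy
    refine card_lt_card (ssubset_iff_of_subset ?_ |>.2 ⟨x, by simp [hx, hxy], by simp⟩)
    intro z hz
    simp only [mem_filter] at hz ⊢
    exact ⟨hz.1, hz.2.trans hxy⟩
  have hinj : Set.InjOn rank s := by
    intro x hx y hy hxy
    by_contra hne
    rcases lt_or_gt_of_ne (hf.ne hne) with h | h
    · exact (hmono x hx y hy h).ne hxy
    · exact (hmono y hy x hx h).ne hxy.symm
  have himage : s.image rank = range s.card := by
    refine eq_of_subset_of_card_le ?_ (by rw [card_image_of_injOn hinj, card_range])
    intro r hr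
    obtain ⟨x, hx, rfl⟩ := mem_image.1 hr
    refine mem_range.2 (card_lt_card (ssubset_iff_of_subset (filter_subset _ _) |>.2
      ⟨x, hx, by simp⟩))
  have h1 : (s.filter fun x => rank x < m).card = ((s.image rank).filter (· < m)).card := by
    rw [filter_image, card_image_of_injOn (hinj.mono fun x hx => (mem_filter.1 hx).1)]
  rw [h1, himage]
  have : (range s.card).filter (· < m) = range m := by
    ext x; simp only [mem_filter, mem_range]; omega
  rw [this, card_range]

variable {n : ℕ}

/-! ### Levels, shades and local LYM -/

lemma mem_level {r : ℕ} {S : Finset (Fin n)} : S ∈ level n r ↔ S.card = r := by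
  simp [level]

lemma card_level (n r : ℕ) : (level n r).card = n.choose r := by
  simp [level]

lemma sized_of_subset_level {r : ℕ} {P : Finset (Finset (Fin n))} (hP : P ⊆ level n r) :
    (P : Set (Finset (Fin n))).Sized r := fun _ hS => mem_level.1 (hP hS)

lemma compls_level {r : ℕ} (hr : r ≤ n) : (level n r)ᶜˢ = level n (n - r) := by
  ext S
  have := S.card_le_univ
  simp only [mem_compls, mem_level, card_compl, Fintype.card_fin] at *
  omega

lemma upShadow_subset_level {r : ℕ} {P : Finset (Finset (Fin n))} (hP : P ⊆ level n r) :
    ∂⁺ P ⊆ level n (r + 1) :=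
  fun _ hS => mem_level.2 ((sized_of_subset_level hP).upShadow hS)

lemma upShadow_level {r : ℕ} : ∂⁺ (level n r) = level n (r + 1) := by
  refine (upShadow_subset_level subset_rfl).antisymm fun S hS => ?_
  rw [mem_level] at hS
  obtain ⟨a, ha⟩ : S.Nonempty := by rw [← card_pos]; omega
  refine mem_upShadow_iff_erase_mem.2 ⟨a, ha, mem_level.2 ?_⟩
  rw [card_erase_of_mem ha]; omega

lemma card_upShadow_eq_card_shadow_compls (P : Finset (Finset (Fin n))) :
    (∂⁺ P).card = (∂ Pᶜˢ).card := by
  rw [shadow_compls, card_compls]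

lemma card_mul_le_card_upShadow_mul {r : ℕ} (hr : r ≤ n) {P : Finset (Finset (Fin n))}
    (hP : (P : Set (Finset (Fin n))).Sized r) :
    P.card * (n - r) ≤ (∂⁺ P).card * (r + 1) := by
  have h := local_lubell_yamamoto_meshalkin_inequality_mul hP.compls
  rw [card_compls, ← card_upShadow_eq_card_shadow_compls, Fintype.card_fin] at h
  rwa [Nat.sub_sub_self hr] at h

lemma upShadow_union (P Q : Finset (Finset (Fin n))) : ∂⁺ (P ∪ Q) = ∂⁺ P ∪ ∂⁺ Q := by
  ext S
  simp only [mem_union, mem_upShadow_iff_exists_mem_card_add_one]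
  aesop

lemma card_upShadow_union_add_card_upShadow_inter_le (P Q : Finset (Finset (Fin n))) :
    (∂⁺ (P ∪ Q)).card + (∂⁺ (P ∩ Q)).card ≤ (∂⁺ P).card + (∂⁺ Q).card := by
  rw [← card_union_add_card_inter (∂⁺ P), upShadow_union]
  gcongr
  exact subset_inter (upShadow_monotone inter_subset_left) (upShadow_monotone inter_subset_right)

/-! ### Initial and final segments of the squashed order -/

lemma toColex_compl_lt_toColex_compl {S T : Finset (Fin n)} :
    toColex Sᶜ < toColex Tᶜ ↔ toColex T < toColex S := by
  simp only [Colex.toColex_lt_toColex_iff_exists_forall_lt, mem_compl, not_not]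
  constructor
  · rintro ⟨a, h1, h2, h3⟩; exact ⟨a, h2, h1, fun b hb hb' => h3 b hb' hb⟩
  · rintro ⟨a, h1, h2, h3⟩; exact ⟨a, h2, h1, fun b hb hb' => h3 b hb' hb⟩

lemma card_firstSets {r m : ℕ} (hm : m ≤ n.choose r) : (firstSets n r m).card = m :=
  card_filter_card_lt (level n r) (f := toColex) toColex.injective (by rwa [card_level])

lemma isInitSeg_firstSets (n r m : ℕ) : Colex.IsInitSeg (firstSets n r m) r := by
  refine ⟨fun S hS => mem_level.1 (mem_filter.1 hS).1, ?_⟩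
  rintro S T hS ⟨hTS, hT⟩
  rw [firstSets, mem_filter] at hS ⊢
  refine ⟨mem_level.2 hT, (card_le_card ?_).trans_lt hS.2⟩
  intro U hU
  rw [mem_filter] at hU ⊢
  exact ⟨hU.1, hU.2.trans hTS⟩

/-- Complementation reverses the squashed order; this carries Kruskal–Katona from shadows to shades.
-/
lemma compls_lastSets {r : ℕ} (hr : r ≤ n) (m : ℕ) :
    (lastSets n r m)ᶜˢ = firstSets n (n - r) m := by
  have h2 : ∀ S : Finset (Fin n), ((level n r).filter fun T => toColex Sᶜ < toColex T).card =
      ((level n (n - r)).filter fun T => toColex T < toColex S).card := by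
    intro S
    rw [← compls_level hr, ← card_compls]
    congr 1
    ext T
    simp only [mem_compls, mem_filter, toColex_compl_lt_toColex_compl]
  ext S
  rw [mem_compls, lastSets, firstSets, mem_filter, mem_filter, h2, ← compls_level hr, mem_compls]

lemma card_lastSets {r m : ℕ} (hr : r ≤ n) (hm : m ≤ n.choose r) : (lastSets n r m).card = m := by
  rw [← card_compls, compls_lastSets hr, card_firstSets (by rwa [Nat.choose_symm hr])]

lemma card_upShadow_lastSets {r : ℕ} (hr : r ≤ n) (m : ℕ) :
    (∂⁺ (lastSets n r m)).card = (∂ (firstSets n (n - r) m)).card := by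
  rw [card_upShadow_eq_card_shadow_compls, compls_lastSets hr]

lemma lastSets_subset_level (n r m : ℕ) : lastSets n r m ⊆ level n r := filter_subset _ _

/-- The Kruskal–Katona theorem for upper shadows. -/
lemma card_upShadow_lastSets_le {r : ℕ} (hr : r ≤ n) {P : Finset (Finset (Fin n))}
    (hP : P ⊆ level n r) : (∂⁺ (lastSets n r P.card)).card ≤ (∂⁺ P).card := by
  have hcard : P.card ≤ n.choose r := (card_le_card hP).trans_eq (card_level n r)
  rw [card_upShadow_lastSets hr, card_upShadow_eq_card_shadow_compls]
  refine kruskal_katona (r := n - r) ?_ ?_ (isInitSeg_firstSets _ _ _)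
  · simpa using (sized_of_subset_level hP).compls
  · rw [card_compls, card_firstSets (by rwa [Nat.choose_symm hr])]

/-! ### Two families in the middle level -/

lemma card_upShadow_map (σ : Equiv.Perm (Fin n)) (P : Finset (Finset (Fin n))) :
    (∂⁺ (P.map (mapEmbedding σ.toEmbedding).toEmbedding)).card = (∂⁺ P).card := by
  have : ∂⁺ (P.map (mapEmbedding σ.toEmbedding).toEmbedding) =
      (∂⁺ P).map (mapEmbedding σ.toEmbedding).toEmbedding := by
    ext S
    simp only [mem_upShadow_iff, mem_map]
    constructor
    · rintro ⟨_, ⟨T, hT, rfl⟩, a, ha, rfl⟩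
      refine ⟨_, ⟨T, hT, σ.symm a, ?_, rfl⟩, ?_⟩
      · simpa using ha
      · simp
    · rintro ⟨_, ⟨T, hT, a, ha, rfl⟩, rfl⟩
      refine ⟨_, ⟨T, hT, rfl⟩, σ a, ?_, ?_⟩
      · simpa using ha
      · simp
  rw [this, card_map]

/-- Two families whose sizes add up to at least the size of a level can be replaced by the full
level and a family of the residual size, without increasing the total size of the shades. -/
lemma exists_card_upShadow_level_add_le {r : ℕ} : ∀ (m : ℕ) (P Q : Finset (Finset (Fin n))),
    Q.card = m → P ⊆ level n r → Q ⊆ level n r → n.choose r ≤ P.card + Q.card →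
    ∃ R ⊆ level n r, n.choose r + R.card = P.card + Q.card ∧
      (∂⁺ (level n r)).card + (∂⁺ R).card ≤ (∂⁺ P).card + (∂⁺ Q).card := by
  intro m
  induction m using Nat.strong_induction_on with
  | _ m ih =>
    intro P Q hm hP hQ hPQ
    by_cases hPl : P = level n r
    · exact ⟨Q, hQ, by rw [hPl, card_level], by rw [hPl]⟩
    have hlt : P.card < n.choose r := by
      rw [← card_level]; exact card_lt_card (ssubset_of_subset_of_ne hP hPl)
    obtain ⟨T, hT, hTP⟩ := exists_of_ssubset (ssubset_of_subset_of_ne hP hPl)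
    obtain ⟨S, hS⟩ : Q.Nonempty := by rw [← card_pos]; omega
    -- Moving `S` onto the missing set `T` puts `T` in `Q'` but not in `P`, so `P ∩ Q'` is smaller
    -- than `Q` and the induction proceeds.
    obtain ⟨σ, hσ⟩ := Equiv.Perm.exists_map_finset_eq _ _ ((mem_level.1 (hQ hS)).trans (mem_level.1 hT).symm)
    set Q' := Q.map (mapEmbedding σ.toEmbedding).toEmbedding with hQ'
    have hQ'l : Q' ⊆ level n r := by
      intro U hU
      obtain ⟨V, hV, rfl⟩ := mem_map.1 hU
      simpa [mem_level] using mem_level.1 (hQ hV)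
    have hcard : Q'.card = Q.card := card_map _
    have hTQ' : T ∈ Q' := mem_map.2 ⟨S, hS, hσ⟩
    have hinter : (P ∩ Q').card < m := by
      rw [← hm, ← hcard]
      exact card_lt_card (ssubset_iff_of_subset inter_subset_right |>.2
        ⟨T, hTQ', fun h => hTP (mem_inter.1 h).1⟩)
    have hsum := card_union_add_card_inter P Q'
    have hsub := card_upShadow_union_add_card_upShadow_inter_le P Q'
    obtain ⟨R, hR, hR1, hR2⟩ := ih _ hinter (P ∪ Q') (P ∩ Q') rfl (union_subset hP hQ'l)
      (inter_subset_left.trans hP) (by omega)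
    have hmap := card_upShadow_map σ Q
    rw [← hQ'] at hmap
    exact ⟨R, hR, by omega, by omega⟩

lemma kappaStar_le {n r k i : ℕ} (hi : i ≤ k) : kappaStar n r k ≤ kappa n r i :=
  inf'_le _ (mem_range.2 (by omega))

lemma kappa_zero (n r : ℕ) : kappa n r 0 = 0 := by
  have : firstSets n r 0 = ∅ := by simp [firstSets]
  simp [kappa, this]

/-- The numerical core: uncrossing and Kruskal–Katona when the sizes reach a full level, local LYM
and `kappaStar ≤ 0` otherwise. -/
lemma card_add_card_add_choose_le {h k : ℕ} (hn : n = 2 * h) {P Q : Finset (Finset (Fin n))}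
    (hP : P ⊆ level n h) (hQ : Q ⊆ level n h) (hk : P.card + Q.card ≤ n.choose h + k) :
    (P.card : ℤ) + Q.card + n.choose (h + 1) + kappaStar n h k ≤
      n.choose h + (∂⁺ P).card + (∂⁺ Q).card := by
  rcases le_total (n.choose h) (P.card + Q.card) with hN | hN
  · obtain ⟨R, hR, hR1, hR2⟩ := exists_card_upShadow_level_add_le _ P Q rfl hP hQ hN
    have h1 := card_upShadow_lastSets_le (by omega) hR
    rw [card_upShadow_lastSets (by omega), show n - h = h by omega] at h1
    have h2 : kappaStar n h k ≤ kappa n h R.card := kappaStar_le (by omega)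
    rw [upShadow_level, card_level] at hR2
    rw [kappa] at h2
    omega
  · have h1 := card_mul_le_card_upShadow_mul (by omega) (sized_of_subset_level hP)
    have h2 := card_mul_le_card_upShadow_mul (by omega) (sized_of_subset_level hQ)
    have h3 : kappaStar n h k ≤ 0 := (kappaStar_le (Nat.zero_le k)).trans_eq (kappa_zero n h)
    have h4 := Nat.choose_succ_right_eq n h
    rw [show n - h = h by omega] at h1 h2 h4
    zify at h1 h2 h4 hN
    have h5 : (0 : ℤ) ≤ (h + 1) * (n.choose h + (∂⁺ P).card + (∂⁺ Q).card -
        (P.card + Q.card + n.choose (h + 1))) := by linarith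
    have := nonneg_of_mul_nonneg_right h5 (by positivity)
    linarith

/-! ### Pairs of antichains whose disjoint members are complementary -/

/-- Two antichains such that any two disjoint members, one from each, are complementary. -/
structure IsComplPair (A B : Finset (Finset (Fin n))) : Prop where
  left : IsAntichain (· ⊆ ·) (A : Set (Finset (Fin n)))
  right : IsAntichain (· ⊆ ·) (B : Set (Finset (Fin n)))
  eq_compl : ∀ S ∈ A, ∀ T ∈ B, Disjoint S T → T = Sᶜ

lemma IsComplPair.symm {A B : Finset (Finset (Fin n))} (h : IsComplPair A B) :
    IsComplPair B A :=
  ⟨h.right, h.left, fun S hS T hT hST => by rw [h.eq_compl T hT S hS hST.symm, compl_compl]⟩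

lemma card_inter_compls_comm (A B : Finset (Finset (Fin n))) :
    (A ∩ Bᶜˢ).card = (B ∩ Aᶜˢ).card := by
  rw [← card_compls, compls_inter, compls_compls, inter_comm]

/-- The upper shadow of the lowest level of an antichain can replace that level. -/
lemma IsComplPair.exists_lt_of_card_lt {h : ℕ} (hn : n = 2 * h) {A B : Finset (Finset (Fin n))}
    (hAB : IsComplPair A B) {S : Finset (Fin n)} (hS : S ∈ A) (hSh : S.card < h) :
    ∃ A', IsComplPair A' B ∧ A' ∩ Bᶜˢ ⊆ A ∩ Bᶜˢ ∧ A.card < A'.card := by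
  obtain ⟨M, hM, hmin⟩ := exists_min_image A card ⟨S, hS⟩
  set r := M.card with hr
  have hrh : r < h := (hmin S hS).trans_lt hSh
  have hup : ∀ U ∈ ∂⁺ (A.slice r), ∃ V ∈ A, V ⊂ U ∧ V.card = r ∧ U.card = r + 1 := by
    intro U hU
    obtain ⟨V, hV, hVU, hc⟩ := mem_upShadow_iff_exists_mem_card_add_one.1 hU
    rw [mem_slice] at hV
    exact ⟨V, hV.1, ssubset_of_subset_of_ne hVU (by rintro rfl; omega), hV.2, by omega⟩
  -- If `U` missed `T`, so would `V ⊂ U`; then `T = Vᶜ`, forcing `U ⊆ V`. New sets thus create no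
  -- disjoint pairs.
  have hnot : ∀ U ∈ ∂⁺ (A.slice r), ∀ T ∈ B, ¬ Disjoint U T := by
    intro U hU T hT hUT
    obtain ⟨V, hV, hVU, -⟩ := hup U hU
    rw [hAB.eq_compl V hV T hT (hUT.mono_left hVU.1)] at hUT
    exact hVU.2 (disjoint_compl_right_iff.1 hUT)
  have hnotA : ∀ U ∈ ∂⁺ (A.slice r), ∀ X ∈ A, ¬ U ⊆ X := by
    intro U hU X hX hUX
    obtain ⟨V, hV, hVU, -⟩ := hup U hU
    exact hVU.not_subset ((hAB.left.eq hV hX (hVU.1.trans hUX)) ▸ hUX)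
  have hnotA' : ∀ U ∈ ∂⁺ (A.slice r), ∀ X ∈ A \ A.slice r, ¬ X ⊆ U := by
    intro U hU X hX hXU
    obtain ⟨V, hV, hVU, hVr, hUr⟩ := hup U hU
    rw [mem_sdiff, mem_slice] at hX
    have h1 := hmin X hX.1
    have h2 : X.card ≠ r := fun h => hX.2 ⟨hX.1, h⟩
    have : X = U := eq_of_subset_of_card_le hXU (by omega)
    exact hnotA U hU X hX.1 this.ge
  refine ⟨(A \ A.slice r) ∪ ∂⁺ (A.slice r), ⟨?_, hAB.right, ?_⟩, ?_, ?_⟩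
  · intro X hX Y hY hne hXY
    rw [mem_coe, mem_union] at hX hY
    rcases hX with hX | hX <;> rcases hY with hY | hY
    · exact hAB.left (mem_sdiff.1 hX).1 (mem_sdiff.1 hY).1 hne hXY
    · exact hnotA' Y hY X hX hXY
    · exact hnotA X hX Y (mem_sdiff.1 hY).1 hXY
    · obtain ⟨-, -, -, -, h1⟩ := hup X hX
      obtain ⟨-, -, -, -, h2⟩ := hup Y hY
      exact hne (eq_of_subset_of_card_le hXY (by omega))
  · intro X hX T hT hXT
    rcases mem_union.1 hX with hX | hX
    · exact hAB.eq_compl X (mem_sdiff.1 hX).1 T hT hXT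
    · exact absurd hXT (hnot X hX T hT)
  · intro X hX
    obtain ⟨hX, hXB⟩ := mem_inter.1 hX
    rcases mem_union.1 hX with hX | hX
    · exact mem_inter.2 ⟨(mem_sdiff.1 hX).1, hXB⟩
    · exact absurd disjoint_compl_right (hnot X hX _ (mem_compls.1 hXB))
  · have hdisj : Disjoint (A \ A.slice r) (∂⁺ (A.slice r)) :=
      disjoint_left.2 fun X hX hX' => hnotA' X hX' X hX subset_rfl
    have hsl : A.slice r ⊆ A := slice_subset
    rw [card_union_of_disjoint hdisj]
    have h1 := card_sdiff_add_card_eq_card hsl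
    have h2 := card_mul_le_card_upShadow_mul (by omega) (sized_slice (𝒜 := A) (r := r))
    have h3 : 0 < (A.slice r).card := card_pos.2 ⟨M, mem_slice.2 ⟨hM, rfl⟩⟩
    have h4 : (A.slice r).card < (∂⁺ (A.slice r)).card := by
      refine lt_of_mul_lt_mul_right (a := r + 1) (lt_of_lt_of_le ?_ h2) (by omega)
      exact (Nat.mul_lt_mul_left h3).2 (by omega)
    omega

/-- The shadow of the highest level of an antichain can replace that level. -/
lemma IsComplPair.exists_lt_of_lt_card {h : ℕ} (hn : n = 2 * h) {A B : Finset (Finset (Fin n))}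
    (hAB : IsComplPair A B) (hB : ∀ T ∈ B, h ≤ T.card)
    {S : Finset (Fin n)} (hS : S ∈ A) (hSh : h + 1 < S.card) :
    ∃ A', IsComplPair A' B ∧ A' ∩ Bᶜˢ ⊆ A ∩ Bᶜˢ ∧ A.card < A'.card := by
  obtain ⟨M, hM, hmax⟩ := exists_max_image A card ⟨S, hS⟩
  set r := M.card with hr
  have hrh : h + 1 < r := hSh.trans_le (hmax S hS)
  have hdown : ∀ U ∈ ∂ (A.slice r), ∃ V ∈ A, U ⊂ V ∧ V.card = r ∧ U.card + 1 = r := by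
    intro U hU
    obtain ⟨V, hV, hVU, hc⟩ := mem_shadow_iff_exists_mem_card_add_one.1 hU
    rw [mem_slice] at hV
    exact ⟨V, hV.1, ssubset_of_subset_of_ne hVU (by rintro rfl; omega), hV.2, by omega⟩
  -- Sizes at least h + 1 and h exceed n together. Pushing level h + 1 down would lose this, hence
  -- the strict bound `h + 1 < S.card`.
  have hnot : ∀ U ∈ ∂ (A.slice r), ∀ T ∈ B, ¬ Disjoint U T := by
    intro U hU T hT hUT
    obtain ⟨-, -, -, -, hUr⟩ := hdown U hU
    have h1 := card_le_univ (U ∪ T)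
    rw [card_union_of_disjoint hUT, Fintype.card_fin] at h1
    have := hB T hT
    omega
  have hnotA : ∀ U ∈ ∂ (A.slice r), ∀ X ∈ A, ¬ X ⊆ U := by
    intro U hU X hX hXU
    obtain ⟨V, hV, hUV, -⟩ := hdown U hU
    exact hUV.not_subset ((hAB.left.eq hX hV (hXU.trans hUV.1)) ▸ hXU)
  have hnotA' : ∀ U ∈ ∂ (A.slice r), ∀ X ∈ A \ A.slice r, ¬ U ⊆ X := by
    intro U hU X hX hUX
    obtain ⟨V, hV, hUV, hVr, hUr⟩ := hdown U hU
    rw [mem_sdiff, mem_slice] at hX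
    have h1 := hmax X hX.1
    have h2 : X.card ≠ r := fun h => hX.2 ⟨hX.1, h⟩
    have : U = X := eq_of_subset_of_card_le hUX (by omega)
    exact hnotA U hU X hX.1 this.ge
  refine ⟨(A \ A.slice r) ∪ ∂ (A.slice r), ⟨?_, hAB.right, ?_⟩, ?_, ?_⟩
  · intro X hX Y hY hne hXY
    rw [mem_coe, mem_union] at hX hY
    rcases hX with hX | hX <;> rcases hY with hY | hY
    · exact hAB.left (mem_sdiff.1 hX).1 (mem_sdiff.1 hY).1 hne hXY
    · exact hnotA Y hY X (mem_sdiff.1 hX).1 hXY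
    · exact hnotA' X hX Y hY hXY
    · obtain ⟨-, -, -, -, h1⟩ := hdown X hX
      obtain ⟨-, -, -, -, h2⟩ := hdown Y hY
      exact hne (eq_of_subset_of_card_le hXY (by omega))
  · intro X hX T hT hXT
    rcases mem_union.1 hX with hX | hX
    · exact hAB.eq_compl X (mem_sdiff.1 hX).1 T hT hXT
    · exact absurd hXT (hnot X hX T hT)
  · intro X hX
    obtain ⟨hX, hXB⟩ := mem_inter.1 hX
    rcases mem_union.1 hX with hX | hX
    · exact mem_inter.2 ⟨(mem_sdiff.1 hX).1, hXB⟩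
    · exact absurd disjoint_compl_right (hnot X hX _ (mem_compls.1 hXB))
  · have hdisj : Disjoint (A \ A.slice r) (∂ (A.slice r)) :=
      disjoint_left.2 fun X hX hX' => hnotA' X hX' X hX subset_rfl
    have hsl : A.slice r ⊆ A := slice_subset
    rw [card_union_of_disjoint hdisj]
    have h1 := card_sdiff_add_card_eq_card hsl
    have h2 := local_lubell_yamamoto_meshalkin_inequality_mul (sized_slice (𝒜 := A) (r := r))
    rw [Fintype.card_fin] at h2
    have h3 : 0 < (A.slice r).card := card_pos.2 ⟨M, mem_slice.2 ⟨hM, rfl⟩⟩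
    have h5 : r ≤ n := by simpa using card_le_univ M
    have h4 : (A.slice r).card < (∂ (A.slice r)).card := by
      refine lt_of_mul_lt_mul_right (a := n - r + 1) (lt_of_lt_of_le ?_ h2) (by omega)
      exact (Nat.mul_lt_mul_left h3).2 (by omega)
    omega

lemma IsComplPair.exists_lt_or_subset {h : ℕ} (hn : n = 2 * h) {A B : Finset (Finset (Fin n))}
    (hAB : IsComplPair A B) :
    (∃ A' B' : Finset (Finset (Fin n)), IsComplPair A' B' ∧ (A' ∩ B'ᶜˢ).card ≤ (A ∩ Bᶜˢ).card ∧
      A.card + B.card < A'.card + B'.card) ∨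
    (A ⊆ level n h ∪ level n (h + 1) ∧ B ⊆ level n h ∪ level n (h + 1)) := by
  by_contra! hcon
  obtain ⟨hmax, hsub⟩ := hcon
  have hleft : ∀ A', IsComplPair A' B → A' ∩ Bᶜˢ ⊆ A ∩ Bᶜˢ → A'.card ≤ A.card := by
    intro A' h1 h2
    have := hmax A' B h1 (card_le_card h2)
    omega
  have hright : ∀ B', IsComplPair B' A → B' ∩ Aᶜˢ ⊆ B ∩ Aᶜˢ → B'.card ≤ B.card := by
    intro B' h1 h2
    have := hmax A B' h1.symm (by
      rw [card_inter_compls_comm, card_inter_compls_comm A B]; exact card_le_card h2)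
    omega
  have hA : ∀ S ∈ A, h ≤ S.card := by
    intro S hS
    by_contra! hlt
    obtain ⟨A', h1, h2, h3⟩ := hAB.exists_lt_of_card_lt hn hS hlt
    exact absurd (hleft A' h1 h2) (by omega)
  have hB : ∀ S ∈ B, h ≤ S.card := by
    intro S hS
    by_contra! hlt
    obtain ⟨B', h1, h2, h3⟩ := hAB.symm.exists_lt_of_card_lt hn hS hlt
    exact absurd (hright B' h1 h2) (by omega)
  refine hsub ?_ ?_
  · intro S hS
    have h0 := hA S hS
    have : S.card ≤ h + 1 := by
      by_contra! hlt
      obtain ⟨A', h1, h2, h3⟩ := hAB.exists_lt_of_lt_card hn hB hS hlt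
      exact absurd (hleft A' h1 h2) (by omega)
    simp only [mem_union, mem_level]
    omega
  · intro S hS
    have h0 := hB S hS
    have : S.card ≤ h + 1 := by
      by_contra! hlt
      obtain ⟨B', h1, h2, h3⟩ := hAB.symm.exists_lt_of_lt_card hn hA hS hlt
      exact absurd (hright B' h1 h2) (by omega)
    simp only [mem_union, mem_level]
    omega

/-! ### Pairs on the two middle levels: bound and equality -/

lemma slice_subset_level (A : Finset (Finset (Fin n))) (r : ℕ) : A.slice r ⊆ level n r :=
  fun _ hS => mem_level.2 (mem_slice.1 hS).2

lemma eq_slice_union_slice {r : ℕ} {A : Finset (Finset (Fin n))}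
    (hA : A ⊆ level n r ∪ level n (r + 1)) : A = A.slice r ∪ A.slice (r + 1) := by
  ext S
  simp only [mem_union, mem_slice]
  constructor
  · intro hS
    have := hA hS
    simp only [mem_union, mem_level] at this
    tauto
  · tauto

lemma slice_succ_subset {r : ℕ} {A : Finset (Finset (Fin n))}
    (hA : IsAntichain (· ⊆ ·) (A : Set (Finset (Fin n)))) :
    A.slice (r + 1) ⊆ level n (r + 1) \ ∂⁺ (A.slice r) := by
  intro S hS
  rw [mem_sdiff]
  refine ⟨slice_subset_level _ _ hS, fun hS' => ?_⟩
  obtain ⟨T, hT, hTS, hc⟩ := mem_upShadow_iff_exists_mem_card_add_one.1 hS'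
  have := hA.eq (mem_slice.1 hT).1 (mem_slice.1 hS).1 hTS
  rw [this] at hc
  omega

lemma card_level_sdiff_upShadow_slice (A : Finset (Finset (Fin n))) (r : ℕ) :
    (level n (r + 1) \ ∂⁺ (A.slice r)).card + (∂⁺ (A.slice r)).card = n.choose (r + 1) := by
  rw [← card_level]
  exact card_sdiff_add_card_eq_card (upShadow_subset_level (slice_subset_level A r))

lemma card_add_card_upShadow_slice_le {r : ℕ} {A : Finset (Finset (Fin n))}
    (hA : IsAntichain (· ⊆ ·) (A : Set (Finset (Fin n))))
    (hAr : A ⊆ level n r ∪ level n (r + 1)) :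
    A.card + (∂⁺ (A.slice r)).card ≤ (A.slice r).card + n.choose (r + 1) := by
  have h1 := card_union_le (A.slice r) (A.slice (r + 1))
  rw [← eq_slice_union_slice hAr] at h1
  have h2 := card_le_card (slice_succ_subset (r := r) hA)
  have h3 := card_level_sdiff_upShadow_slice A r
  omega

/-- Level h is closed under complement, so one slice and the complements of the other share a level
and overlap in at most k sets. -/
lemma card_slice_add_card_slice_le {h k : ℕ} (hn : n = 2 * h) {A B : Finset (Finset (Fin n))}
    (hk : (A ∩ Bᶜˢ).card ≤ k) : (A.slice h).card + (B.slice h).card ≤ n.choose h + k := by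
  rw [← card_compls (B.slice h), ← card_union_add_card_inter, ← card_level]
  refine add_le_add (card_le_card (union_subset (slice_subset_level A h) ?_))
    ((card_le_card ?_).trans hk)
  · refine compls_subset_iff.2 ?_
    rw [compls_level (by omega), show n - h = h by omega]
    exact slice_subset_level B h
  · refine inter_subset_inter slice_subset (compls_subset_compls.2 slice_subset)

theorem IsComplPair.card_add_card_le {h k : ℕ} (hn : n = 2 * h) {A B : Finset (Finset (Fin n))}
    (hAB : IsComplPair A B) (hk : (A ∩ Bᶜˢ).card ≤ k) :
    (A.card : ℤ) + B.card ≤ n.choose h + n.choose (h + 1) - kappaStar n h k := by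
  -- The total size is bounded, so the enlarging moves terminate.
  induction hd : 2 * (univ : Finset (Finset (Fin n))).card - (A.card + B.card) using
    Nat.strong_induction_on generalizing A B with
  | _ d ih =>
    rcases hAB.exists_lt_or_subset hn with ⟨A', B', h1, h2, h3⟩ | ⟨hA, hB⟩
    · have hA' := card_le_univ A'
      have hB' := card_le_univ B'
      have := ih _ (by rw [card_univ] at hd; rw [card_univ]; omega) h1 (h2.trans hk) rfl
      omega
    · have h1 := card_add_card_upShadow_slice_le hAB.left hA
      have h2 := card_add_card_upShadow_slice_le hAB.right hB
      have h3 := card_add_card_add_choose_le hn (slice_subset_level A h) (slice_subset_level B h)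
        (card_slice_add_card_slice_le hn hk)
      omega

/-- The structure of the first family of an extremal pair. -/
theorem IsComplPair.structure_of_card_eq {h k : ℕ} (hn : n = 2 * h)
    {A B : Finset (Finset (Fin n))} (hAB : IsComplPair A B) (hk : (A ∩ Bᶜˢ).card ≤ k)
    (hcard : (n.choose h : ℤ) + n.choose (h + 1) - kappaStar n h k ≤ A.card + B.card) :
    A ⊆ level n h ∪ level n (h + 1) ∧
    A = A.slice h ∪ (level n (h + 1) \ ∂⁺ (A.slice h)) ∧
    (∂⁺ (A.slice h)).card = (∂⁺ (lastSets n h (A.slice h).card)).card ∧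
    ∀ G ⊆ level n h, G.card = (A.slice h).card → (∂⁺ (A.slice h)).card ≤ (∂⁺ G).card := by
  have hAl := slice_subset_level A h
  obtain ⟨hA, hB⟩ : A ⊆ level n h ∪ level n (h + 1) ∧ B ⊆ level n h ∪ level n (h + 1) := by
    refine (hAB.exists_lt_or_subset hn).resolve_left ?_
    rintro ⟨A', B', h1, h2, h3⟩
    have := h1.card_add_card_le hn (h2.trans hk)
    omega
  have hB1 := card_add_card_upShadow_slice_le hAB.right hB
  have hsum := card_slice_add_card_slice_le hn hk
  -- The numerical bound needs no relation between `G` and `B` beyond sizes, so `G` may stand in for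
  -- the slice of `A`.
  have hmin : ∀ G ⊆ level n h, G.card = (A.slice h).card →
      (∂⁺ (A.slice h)).card ≤ (∂⁺ G).card := by
    intro G hG hGA
    have h1 := card_add_card_upShadow_slice_le hAB.left hA
    have h2 := card_add_card_add_choose_le (k := k) hn hG (slice_subset_level B h) (by omega)
    omega
  refine ⟨hA, ?_, le_antisymm ?_ ?_, hmin⟩
  · have h1 := card_add_card_add_choose_le hn hAl (slice_subset_level B h) hsum
    have h2 := card_level_sdiff_upShadow_slice A h
    have h3 := card_union_le (A.slice h) (level n (h + 1) \ ∂⁺ (A.slice h))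
    refine eq_of_subset_of_card_le ?_ (by omega)
    conv_lhs => rw [eq_slice_union_slice hA]
    exact union_subset_union_right (slice_succ_subset hAB.left)
  · refine hmin _ (lastSets_subset_level _ _ _) (card_lastSets (by omega) ?_)
    exact (card_le_card hAl).trans_eq (card_level n h)
  · exact card_upShadow_lastSets_le (by omega) hAl

/-! ### Reduction to complementary pairs -/

/-- If each member of `A` is disjoint from at most one member of `B`, then the members of `B`
disjoint from some member of `A` can be replaced by the complements of those members of `A`. -/
lemma exists_isComplPair {A B : Finset (Finset (Fin n))}
    (hA : IsAntichain (· ⊆ ·) (A : Set (Finset (Fin n))))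
    (hB : IsAntichain (· ⊆ ·) (B : Set (Finset (Fin n))))
    (hl : ∀ S ∈ A, ∀ T ∈ B, ∀ T' ∈ B, Disjoint S T → Disjoint S T' → T = T') :
    ∃ B', IsComplPair A B' ∧ B.card ≤ B'.card ∧
      A ∩ B'ᶜˢ ⊆ A.filter fun S => ∃ T ∈ B, Disjoint S T := by
  set D := A.filter fun S => ∃ T ∈ B, Disjoint S T with hD
  set E := B.filter fun T => ∃ S ∈ A, Disjoint S T with hE
  have hmem : ∀ T, T ∈ (B \ E) ∪ Dᶜˢ ↔ (T ∈ B ∧ ∀ S ∈ A, ¬ Disjoint S T) ∨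
      (Tᶜ ∈ A ∧ ∃ T' ∈ B, Disjoint Tᶜ T') := by
    intro T
    simp only [hD, hE, mem_union, mem_sdiff, mem_filter, mem_compls, not_and, not_exists]
    tauto
  refine ⟨(B \ E) ∪ Dᶜˢ, ⟨hA, ?_, ?_⟩, ?_, ?_⟩
  · intro X hX Y hY hne hXY
    rw [mem_coe, hmem] at hX hY
    rcases hX with ⟨hX, hX'⟩ | ⟨hX, T, hT, hXT⟩ <;> rcases hY with ⟨hY, hY'⟩ | ⟨hY, T', hT', hYT⟩
    · exact hB hX hY hne hXY
    · exact hX' _ hY (disjoint_compl_left_iff.2 hXY)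
    · have hTX : T ⊆ X := disjoint_compl_left_iff.1 hXT
      obtain rfl := hB.eq hT hY (hTX.trans hXY)
      exact hY' _ hX hXT
    · exact hne (compl_injective (hA.eq hY hX (compl_subset_compl.2 hXY)).symm)
  · intro S hS T hT hST
    rcases (hmem T).1 hT with ⟨-, hT'⟩ | ⟨hT, -⟩
    · exact absurd hST (hT' S hS)
    -- Here `S ⊆ Tᶜ` with both in `A`, so the antichain property gives equality.
    · rw [hA.eq hS hT (subset_compl_iff_disjoint_right.2 hST), compl_compl]
  · have hdisj : Disjoint (B \ E) Dᶜˢ := by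
      refine disjoint_left.2 fun T hT hT' => ?_
      simp only [hD, hE, mem_sdiff, mem_filter, mem_compls, not_and, not_exists] at hT hT'
      exact hT.2 hT.1 _ hT'.1 disjoint_compl_left
    -- Each member of `E` misses some member of `D`, and by `hl` none is shared.
    have hED : E.card ≤ D.card := by
      refine card_le_card_of_forall_subsingleton (fun T S => Disjoint S T) ?_ ?_
      · intro T hT
        obtain ⟨hT, S, hS, hST⟩ := mem_filter.1 hT
        exact ⟨S, mem_filter.2 ⟨hS, T, hT, hST⟩, hST⟩
      · intro S hS T hT T' hT'
        exact hl S (mem_filter.1 hS).1 T (mem_filter.1 hT.1).1 T' (mem_filter.1 hT'.1).1 hT.2 hT'.2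
    have h1 := card_sdiff_add_card_eq_card (show E ⊆ B from filter_subset _ _)
    rw [card_union_of_disjoint hdisj, card_compls]
    omega
  · intro S hS
    rw [mem_inter, mem_compls, hmem, compl_compl] at hS
    rcases hS with ⟨hS, ⟨-, h⟩ | ⟨-, h⟩⟩
    · exact absurd disjoint_compl_right (h S hS)
    · exact mem_filter.2 ⟨hS, h⟩

/-- The structure of the first family, for families indexed so that disjoint members share an
index below `k`. -/
lemma structure_of_indexed {h k : ℕ} (hn : n = 2 * h) {A B : Finset (Finset (Fin n))}
    (hA : IsAntichain (· ⊆ ·) (A : Set (Finset (Fin n))))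
    (hB : IsAntichain (· ⊆ ·) (B : Set (Finset (Fin n))))
    (a : Fin A.card ≃ {S : Finset (Fin n) // S ∈ A})
    (b : Fin B.card ≃ {S : Finset (Fin n) // S ∈ B})
    (hab : ∀ (i : Fin A.card) (j : Fin B.card),
      Disjoint (a i : Finset (Fin n)) (b j) → (i : ℕ) = j ∧ (i : ℕ) < k)
    (hcard : (A.card : ℤ) + B.card = n.choose h + n.choose (h + 1) - kappaStar n h k) :
    A ⊆ level n h ∪ level n (h + 1) ∧
    A = A.slice h ∪ (level n (h + 1) \ ∂⁺ (A.slice h)) ∧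
    (∂⁺ (A.slice h)).card = (∂⁺ (lastSets n h (A.slice h).card)).card ∧
    ∀ G ⊆ level n h, G.card = (A.slice h).card → (∂⁺ (A.slice h)).card ≤ (∂⁺ G).card := by
  have hab' : ∀ (S : Finset (Fin n)) (hS : S ∈ A) (T : Finset (Fin n)) (hT : T ∈ B),
      Disjoint S T → (a.symm ⟨S, hS⟩ : ℕ) = b.symm ⟨T, hT⟩ ∧ (a.symm ⟨S, hS⟩ : ℕ) < k := by
    intro S hS T hT hST
    exact hab _ _ (by simpa using hST)
  obtain ⟨B', h1, h2, h3⟩ := exists_isComplPair hA hB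
    (fun S hS T hT T' hT' h h' => by
      have := (hab' S hS T hT h).1.symm.trans (hab' S hS T' hT' h').1
      simpa using b.symm.injective (Fin.ext this))
  refine h1.structure_of_card_eq hn (k := k) ((card_le_card h3).trans ?_) (by omega)
  -- Sets of `A` with a disjoint partner have distinct indices among 0, …, k - 1.
  rw [← card_range k]
  refine card_le_card_of_forall_subsingleton
    (fun S i => ∃ hS : S ∈ A, (a.symm ⟨S, hS⟩ : ℕ) = i) ?_ ?_
  · intro S hS
    obtain ⟨hS, T, hT, hST⟩ := mem_filter.1 hS
    exact ⟨_, mem_range.2 (hab' S hS T hT hST).2, hS, rfl⟩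
  · rintro i - S ⟨-, hS, hi⟩ S' ⟨-, hS', hi'⟩
    simpa using a.symm.injective (Fin.ext (hi.trans hi'.symm))

end CrossAntichain

theorem theorem2p6 (n : ℕ) (hn : 4 ≤ n) (hn_even : Even n)
    (𝒜 ℬ : Finset (Finset (Fin n)))
    (h𝒜 : IsAntichain (· ⊆ ·) (𝒜 : Set (Finset (Fin n))))
    (hℬ : IsAntichain (· ⊆ ·) (ℬ : Set (Finset (Fin n))))
    (k : ℕ) (hk : k ≤ min 𝒜.card ℬ.card)
    (a : Fin 𝒜.card ≃ {S : Finset (Fin n) // S ∈ 𝒜})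
    (b : Fin ℬ.card ≃ {S : Finset (Fin n) // S ∈ ℬ})
    (hab : ∀ (i : Fin 𝒜.card) (j : Fin ℬ.card),
      (a i : Finset (Fin n)) ∩ (b j : Finset (Fin n)) = ∅ → (i : ℕ) = (j : ℕ) ∧ (i : ℕ) < k)
    (hmax : (𝒜.card : ℤ) + (ℬ.card : ℤ) =
      (n.choose (n / 2) : ℤ) + (n.choose (n / 2 + 1) : ℤ)
        - CrossAntichain.kappaStar n (n / 2) k) :
    ∀ 𝒳 : Finset (Finset (Fin n)), (𝒳 = 𝒜 ∨ 𝒳 = ℬ) →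
      𝒳 ⊆ CrossAntichain.level n (n / 2) ∪ CrossAntichain.level n (n / 2 + 1) ∧
      𝒳 = 𝒳.slice (n / 2) ∪ (CrossAntichain.level n (n / 2 + 1) \ ∂⁺ (𝒳.slice (n / 2))) ∧
      (∂⁺ (𝒳.slice (n / 2))).card =
        (∂⁺ (CrossAntichain.lastSets n (n / 2) (𝒳.slice (n / 2)).card)).card ∧
      (∀ 𝒢 : Finset (Finset (Fin n)), 𝒢 ⊆ CrossAntichain.level n (n / 2) →
        𝒢.card = (𝒳.slice (n / 2)).card → (∂⁺ (𝒳.slice (n / 2))).card ≤ (∂⁺ 𝒢).card) := by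
  have hn2 : n = 2 * (n / 2) := (Nat.two_mul_div_two_of_even hn_even).symm
  rintro 𝒳 (rfl | rfl)
  · exact CrossAntichain.structure_of_indexed hn2 h𝒜 hℬ a b
      (fun i j hij => hab i j (Finset.disjoint_iff_inter_eq_empty.1 hij)) hmax
  · refine CrossAntichain.structure_of_indexed hn2 hℬ h𝒜 b a (fun j i hij => ?_)
      (by rw [add_comm]; exact hmax)
    obtain ⟨h1, h2⟩ := hab i j (Finset.disjoint_iff_inter_eq_empty.1 hij.symm)
    exact ⟨h1.symm, h1 ▸ h2⟩
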